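/- Let $V\subset\mathbb R^d$ be bounded and measurable, $\langle g\rangle:=\int_V g(v)\,dv$, and let $\mathbf m=(m_0,\dots,m_N):V\to\mathbb R^{N+1}$ be measurable with $m_0\equiv 1$, $\sup_V|m_i|\le 1$, and $m_0,\dots,m_N$ linearly independent modulo null sets. Let $\mathbb F(V)$ be the set of integrable $g:V\to(0,\infty)$, let $\mathcal R=\{\langle \mathbf m g\rangle: g\in\mathbb F(V)\}$ be the set of realizable moment vectors, and let $\mathcal C$ be a collision operator, mapping functions on $V$ to functions on $V$. Let $\eta:(0,\infty)\to\mathbb R$ be a superlinear kinetic entropy function: $\eta\in C^3$, $\eta''>0$, $\langle\eta'(g)\,\mathcal C(g)\rangle\le 0$ for all $g\in\mathbb F(V)$ for which $\eta'(g)\,\mathcal C(g)$ is integrable, and $\operatorname{range}(\eta')=\operatorname{dom}(\eta_*)=\mathbb R$, where $\eta_*(y)=\sup_{z>0}(yz-\eta(z))$ is the Legendre dual. Put $G_\alpha:=\eta_*'(\alpha\cdot\mathbf m)$ and $\hat u(\alpha):=\langle\mathbf m G_\alpha\rangle$ for $\alpha\in\mathbb R^{N+1}$, and, with Euclidean norms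 and for $\gamma>0$, $$\hat\alpha(u):=\operatorname*{argmax}_{\alpha\in\mathbb R^{N+1}}\{\alpha\cdot u-\langle\eta_*(\alpha\cdot\mathbf m)\rangle\}\ (u\in\mathcal R),\qquad \hat\alpha_\gamma(u):=\operatorname*{argmax}_{\alpha\in\mathbb R^{N+1}}\{\alpha\cdot u-\langle\eta_*(\alpha\cdot\mathbf m)\rangle-\tfrac\gamma2\|\alpha\|^2\}\ (u\in\mathbb R^{N+1}),$$ $$r(u):=\langle\mathbf m\,\mathcal C(G_{\hat\alpha(u)})\rangle\ (u\in\mathcal R),\qquad r_\gamma(u):=\langle\mathbf m\,\mathcal C(G_{\hat\alpha_\gamma(u)})\rangle,\qquad h_\gamma(u):=\langle\eta(G_{\hat\alpha_\gamma(u)})\rangle+\tfrac1{2\gamma}\|\langle\mathbf m G_{\hat\alpha_\gamma(u)}\rangle-u\|^2 .$$ Assume that $\mathcal C(G_\alpha)$ is integrable for every $\alpha\in\mathbb R^{N+1}$ (so that $r$ and $r_\gamma$ are defined), that $r$ is Lipschitz continuous on $\mathcal R$, and that $\lim_{u\to0,\,u\in\mathcal R}r(u)=0$. Define the relative entropy and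 the relative source term by $$h_\gamma(u_\gamma|u):=h_\gamma(u_\gamma)-h_\gamma(u)-\hat\alpha_\gamma(u)\cdot(u_\gamma-u),$$ $$q_\gamma(u_\gamma,u):=(h_\gamma'(u_\gamma)-h_\gamma'(u))\cdot r_\gamma(u_\gamma)-r(u)\cdot\big(h_\gamma''(u)(u_\gamma-u)\big),$$ where $h_\gamma'$ is the gradient and $h_\gamma''$ the Hessian of $h_\gamma$. For $M\in(0,\infty)$ let $\mathcal R^M:=\{\hat u(\alpha):\|\alpha\|\le M\}$. Then for all $M,\gamma_0\in(0,\infty)$ there exist positive constants $C_q$ and $D_q$ such that $$q_\gamma(u_\gamma,u)\le C_q\,h_\gamma(u_\gamma|u)+D_q\,\gamma^2\qquad\text{for all }u_\gamma\in\mathbb R^{N+1},\ u\in\mathcal R^M,\ \gamma\in(0,\gamma_0).$$ -/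

import Mathlib

open Set Filter Topology MeasureTheory

noncomputable section

namespace EntropyMoments

/-- The space `ℝ^{N+1}` of moment vectors and of multiplier vectors, with the Euclidean norm. -/
abbrev Vec (N : ℕ) : Type := EuclideanSpace ℝ (Fin (N + 1))

/-! The kinetic entropy `η` is a function on `(0, ∞)`; it is represented by a function `ℝ → ℝ`
of which only the values on `(0, ∞)` are ever used. -/

/-- The domain of the Legendre dual of `η`: all `y` with `sup_{z > 0} (y z - η z) < ∞`. -/
def legendreDomain (η : ℝ → ℝ) : Set ℝ :=
  {y | BddAbove ((fun z => y * z - η z) '' Ioi 0)}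

/-- The Legendre dual `η_*(y) = sup_{z > 0} (y z - η z)`. -/
def legendreDual (η : ℝ → ℝ) (y : ℝ) : ℝ :=
  sSup ((fun z => y * z - η z) '' Ioi 0)

/-- A maximizer of `F` (it is used only for functions with exactly one maximizer). -/
def argmax {E : Type*} [Nonempty E] (F : E → ℝ) : E :=
  Classical.epsilon fun α => ∀ β, F β ≤ F α

section

variable {Ω : Type*} [MeasureSpace Ω] {N : ℕ}

/-- The set `𝔽(V)` of integrable densities with values in `(0, ∞)`. -/
def Densities (Ω : Type*) [MeasureSpace Ω] : Set (Ω → ℝ) :=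
  {g | Integrable g ∧ ∀ v, 0 < g v}

/-- `η` is a superlinear kinetic entropy function for the collision operator `coll`. -/
structure IsSuperlinearEntropy (coll : (Ω → ℝ) → Ω → ℝ) (η : ℝ → ℝ) : Prop where
  contDiffOn : ContDiffOn ℝ 3 η (Ioi 0)
  deriv2_pos : ∀ z, 0 < z → 0 < deriv (deriv η) z
  /-- The entropy is dissipated by the collision operator. -/
  dissipation : ∀ g ∈ Densities Ω, Integrable (fun v => deriv η (g v) * coll g v) →
    ∫ v, deriv η (g v) * coll g v ≤ 0
  range_deriv : deriv η '' Ioi 0 = univ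
  domain_dual : legendreDomain η = univ

/-- Basis functions: measurable, bounded by one, `m₀ ≡ 1`, linearly independent (modulo null
sets). -/
structure IsMomentBasis (m : Fin (N + 1) → Ω → ℝ) : Prop where
  measurable : ∀ i, Measurable (m i)
  abs_le_one : ∀ i v, |m i v| ≤ 1
  zero_eq_one : ∀ v, m 0 v = 1
  linearIndependent : ∀ c : Vec N, (∀ᵐ v, ∑ i, c i * m i v = 0) → c = 0

/-- The moment vector `⟨m g⟩`. -/
def moments (m : Fin (N + 1) → Ω → ℝ) (g : Ω → ℝ) : Vec N :=
  WithLp.toLp 2 fun i => ∫ v, m i v * g v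

/-- The function `v ↦ α · m(v)`. -/
def pairing (m : Fin (N + 1) → Ω → ℝ) (α : Vec N) (v : Ω) : ℝ :=
  ∑ i, α i * m i v

/-- The set `𝓡` of realizable moment vectors. -/
def realizable (m : Fin (N + 1) → Ω → ℝ) : Set (Vec N) :=
  {u | ∃ g ∈ Densities Ω, moments m g = u}

/-- The entropy ansatz `G_α = η_*'(α · m)`. -/
def ansatz (η : ℝ → ℝ) (m : Fin (N + 1) → Ω → ℝ) (α : Vec N) (v : Ω) : ℝ :=
  deriv (legendreDual η) (pairing m α v)

/-- The moment vector `û(α) = ⟨m η_*'(α · m)⟩` of the entropy ansatz. -/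
def uHat (η : ℝ → ℝ) (m : Fin (N + 1) → Ω → ℝ) (α : Vec N) : Vec N :=
  moments m (ansatz η m α)

/-- The set `𝓡^M = {û(α) : ‖α‖ ≤ M}`. -/
def realizableBall (η : ℝ → ℝ) (m : Fin (N + 1) → Ω → ℝ) (M : ℝ) : Set (Vec N) :=
  uHat η m '' {α | ‖α‖ ≤ M}

/-- The multiplier vector `α̂(u)`, for realizable `u`. -/
def alphaHat (η : ℝ → ℝ) (m : Fin (N + 1) → Ω → ℝ) (u : Vec N) : Vec N :=
  argmax fun α : Vec N => inner ℝ α u - ∫ v, legendreDual η (pairing m α v)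

/-- The regularized multiplier vector `α̂_γ(u)`. -/
def alphaHatReg (η : ℝ → ℝ) (m : Fin (N + 1) → Ω → ℝ) (γ : ℝ) (u : Vec N) : Vec N :=
  argmax fun α : Vec N =>
    inner ℝ α u - (∫ v, legendreDual η (pairing m α v)) - γ / 2 * ‖α‖ ^ 2

/-- The collision term `r(u) = ⟨m C(G_{α̂(u)})⟩`, for realizable `u`. -/
def source (coll : (Ω → ℝ) → Ω → ℝ) (η : ℝ → ℝ) (m : Fin (N + 1) → Ω → ℝ) (u : Vec N) : Vec N :=
  moments m (coll (ansatz η m (alphaHat η m u)))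

/-- The regularized collision term `r_γ(u) = ⟨m C(G_{α̂_γ(u)})⟩`. -/
def sourceReg (coll : (Ω → ℝ) → Ω → ℝ) (η : ℝ → ℝ) (m : Fin (N + 1) → Ω → ℝ) (γ : ℝ)
    (u : Vec N) : Vec N :=
  moments m (coll (ansatz η m (alphaHatReg η m γ u)))

/-- The regularized entropy `h_γ(u) = ⟨η(G_{α̂_γ(u)})⟩ + (1/2γ) ‖⟨m G_{α̂_γ(u)}⟩ - u‖²`. -/
def entropyReg (η : ℝ → ℝ) (m : Fin (N + 1) → Ω → ℝ) (γ : ℝ) (u : Vec N) : ℝ :=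
  (∫ v, η (ansatz η m (alphaHatReg η m γ u) v)) +
    1 / (2 * γ) * ‖moments m (ansatz η m (alphaHatReg η m γ u)) - u‖ ^ 2

/-- The relative entropy `h_γ(w | u) = h_γ(w) - h_γ(u) - α̂_γ(u) · (w - u)`. -/
def relEntropyReg (η : ℝ → ℝ) (m : Fin (N + 1) → Ω → ℝ) (γ : ℝ) (w u : Vec N) : ℝ :=
  entropyReg η m γ w - entropyReg η m γ u - inner ℝ (alphaHatReg η m γ u) (w - u)

/-- The relative source term
`q_γ(w, u) = (h_γ'(w) - h_γ'(u)) · r_γ(w) - r(u) · (h_γ''(u) (w - u))`, where `h_γ'` is the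
gradient of `h_γ` and `h_γ''` its Hessian. -/
def relSource (coll : (Ω → ℝ) → Ω → ℝ) (η : ℝ → ℝ) (m : Fin (N + 1) → Ω → ℝ) (γ : ℝ)
    (w u : Vec N) : ℝ :=
  inner ℝ (gradient (entropyReg η m γ) w - gradient (entropyReg η m γ) u)
      (sourceReg coll η m γ w) -
    inner ℝ (source coll η m u) (fderiv ℝ (gradient (entropyReg η m γ)) u (w - u))

end

end EntropyMoments

end

/- A subset `V` of `ℝ^d` carries the restricted Lebesgue measure. -/
attribute [local instance] MeasureTheory.Measure.Subtype.measureSpace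

namespace EntropyMoments

/-! ### Second order Taylor formula -/

/-! Let `φ(α) = ⟨η_*(α·m)⟩`, a strictly convex function with gradient `U = û` and Hessian `A`. The
regularized multiplier solves `U(α) + γα = u`, and `h_γ` is the convex conjugate of `φ + γ/2 ‖·‖²`.
Hence `h_γ' = α̂_γ`, `h_γ'' = (A + γ)⁻¹`, and the relative entropy is `S + γ/2 ‖β - α‖²`, where `α`,
`β` are the regularized multipliers of `u`, `u_γ` and `S = φ(α) - φ(β) - U(β)·(α - β)`. With `u =
U(a)` and `r` read as a function of the multiplier, the relative source is `(β - α)·r(β) - r(a)·x`,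
where `(A(α) + γ) x = u_γ - u`.

Monotonicity of `U` gives `‖α‖ ≤ ‖a‖ ≤ M` for every `γ`, so all local constants can be taken on the
ball of radius `M + 1`. If `‖β - α‖ ≤ 1`, then `x` equals `β - α` up to a quadratic error, and `r(β)
- r(a)` is `O(‖β - α‖ + γ)` because `U(a) - U(α) = γα`. Young's inequality produces the `γ²` term,
and strong convexity bounds `‖β - α‖²` by `S`. If `‖β - α‖ > 1`, then `S` is bounded below
(`bregman_ge_of_one_le`) and controls `‖U(β)‖` linearly (`norm_U_le`), hence also `r(β)` and `x`.
The unbounded factor `β` occurs only in `β·r(β)`, which entropy dissipation makes nonpositive.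

`exists_relSource_bound` carries out this argument for an abstract potential; `isConvexPotential`
shows that `φ` is one. -/

lemma exists_taylor_two_of_lt {f g g' : ℝ → ℝ} (hf : ∀ x, HasDerivAt f (g x) x)
    (hg : ∀ x, HasDerivAt g (g' x) x) {a b : ℝ} (hab : a < b) :
    ∃ ζ ∈ Icc a b, f b - f a - g a * (b - a) = g' ζ / 2 * (b - a) ^ 2 := by
  have hF : ∀ x, HasDerivAt (fun x => f x - g a * (x - a)) (g x - g a) x := fun x => by
    have := (hf x).sub (((hasDerivAt_id x).sub_const a).const_mul (g a))
    rw [mul_one] at this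
    exact this
  have hG : ∀ x, HasDerivAt (fun x => (x - a) ^ 2) (2 * (x - a)) x := fun x => by
    have := ((hasDerivAt_id x).sub_const a).pow 2
    simp only [Nat.cast_ofNat, Nat.add_one_sub_one, pow_one, mul_one, id_eq] at this
    exact this
  -- Cauchy's mean value theorem against `(x - a)²`, then the mean value theorem for `g`; no
  -- continuity of `g'` is needed.
  obtain ⟨ξ, hξ, h1⟩ := exists_ratio_hasDerivAt_eq_ratio_slope _ _ hab
    (fun x _ => (hF x).continuousAt.continuousWithinAt) (fun x _ => hF x) _ _
    (fun x _ => (hG x).continuousAt.continuousWithinAt) (fun x _ => hG x)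
  obtain ⟨ζ, hζ, h2⟩ := exists_hasDerivAt_eq_slope g g' hξ.1
    (fun x _ => (hg x).continuousAt.continuousWithinAt) (fun x _ => hg x)
  refine ⟨ζ, ⟨hζ.1.le, (hζ.2.trans hξ.2).le⟩, ?_⟩
  have h3 : (ξ - a) ≠ 0 := (sub_pos.2 hξ.1).ne'
  rw [eq_div_iff h3] at h2
  rw [← h2] at h1
  apply mul_right_cancel₀ h3
  linear_combination -h1 / 2

lemma exists_taylor_two {f g g' : ℝ → ℝ} (hf : ∀ x, HasDerivAt f (g x) x)
    (hg : ∀ x, HasDerivAt g (g' x) x) (a b : ℝ) :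
    ∃ ζ ∈ uIcc a b, f b - f a - g a * (b - a) = g' ζ / 2 * (b - a) ^ 2 := by
  rcases lt_trichotomy a b with hab | rfl | hab
  · rw [uIcc_of_le hab.le]
    exact exists_taylor_two_of_lt hf hg hab
  · exact ⟨a, by simp, by simp⟩
  · have hf' : ∀ x, HasDerivAt (fun x => f (-x)) (-g (-x)) x := fun x => by
      have := (hf (-x)).comp x (hasDerivAt_neg x)
      rw [mul_neg_one] at this
      exact this
    have hg' : ∀ x, HasDerivAt (fun x => -g (-x)) (g' (-x)) x := fun x => by
      have := ((hg (-x)).comp x (hasDerivAt_neg x)).neg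
      rw [mul_neg_one, neg_neg] at this
      exact this
    obtain ⟨ζ, hζ, h⟩ := exists_taylor_two_of_lt hf' hg' (neg_lt_neg hab)
    refine ⟨-ζ, ?_, ?_⟩
    · rw [uIcc_of_ge hab.le]
      exact ⟨by linarith [hζ.2], by linarith [hζ.1]⟩
    · simp only [neg_neg] at h
      linear_combination h

/-! ### The derivative of the Legendre dual -/

/-- The part of the hypotheses on a kinetic entropy which does not mention collisions. -/
structure IsSmoothEntropy (η : ℝ → ℝ) : Prop where
  contDiffOn : ContDiffOn ℝ 3 η (Ioi 0)
  deriv2_pos : ∀ z, 0 < z → 0 < deriv (deriv η) z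
  range_deriv : deriv η '' Ioi 0 = univ

namespace IsSmoothEntropy

variable {η : ℝ → ℝ}

lemma contDiffOn_deriv (h : IsSmoothEntropy η) : ContDiffOn ℝ 2 (deriv η) (Ioi 0) :=
  ((contDiffOn_succ_iff_deriv_of_isOpen (n := 2) isOpen_Ioi).1
    (by simpa [two_add_one_eq_three] using h.contDiffOn)).2.2

lemma contDiffOn_deriv2 (h : IsSmoothEntropy η) : ContDiffOn ℝ 1 (deriv (deriv η)) (Ioi 0) :=
  ((contDiffOn_succ_iff_deriv_of_isOpen (n := 1) isOpen_Ioi).1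
    (by simpa [one_add_one_eq_two] using h.contDiffOn_deriv)).2.2

lemma hasDerivAt (h : IsSmoothEntropy η) {z : ℝ} (hz : 0 < z) : HasDerivAt η (deriv η z) z :=
  ((h.contDiffOn.differentiableOn (by norm_num)).differentiableAt
    (Ioi_mem_nhds hz)).hasDerivAt

lemma hasDerivAt_deriv (h : IsSmoothEntropy η) {z : ℝ} (hz : 0 < z) :
    HasDerivAt (deriv η) (deriv (deriv η) z) z :=
  ((h.contDiffOn_deriv.differentiableOn (by norm_num)).differentiableAt
    (Ioi_mem_nhds hz)).hasDerivAt

lemma strictMonoOn_deriv (h : IsSmoothEntropy η) : StrictMonoOn (deriv η) (Ioi 0) :=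
  strictMonoOn_of_deriv_pos (convex_Ioi 0) h.contDiffOn_deriv.continuousOn
    (fun z hz => h.deriv2_pos z (by simpa using hz))

lemma tangent_le (h : IsSmoothEntropy η) {z w : ℝ} (hz : 0 < z) (hw : 0 < w) :
    η z + deriv η z * (w - z) ≤ η w := by
  have hc : ConvexOn ℝ (Ioi 0) η :=
    MonotoneOn.convexOn_of_deriv (convex_Ioi 0) h.contDiffOn.continuousOn
      (by rw [interior_Ioi]; exact h.contDiffOn.differentiableOn (by norm_num))
      (by rw [interior_Ioi]; exact h.strictMonoOn_deriv.monotoneOn)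
  rcases lt_trichotomy z w with hzw | rfl | hzw
  · have := hc.le_slope_of_hasDerivAt hz hw hzw (h.hasDerivAt hz)
    rw [slope_def_field, le_div_iff₀ (sub_pos.2 hzw)] at this
    linarith
  · simp
  · have := hc.slope_le_of_hasDerivAt hw hz hzw (h.hasDerivAt hz)
    rw [slope_def_field, div_le_iff₀ (sub_pos.2 hzw)] at this
    linarith

lemma exists_inverse (h : IsSmoothEntropy η) :
    ∃ g : ℝ → ℝ, (∀ y, 0 < g y) ∧ (∀ y, deriv η (g y) = y) := by
  have : ∀ y, ∃ z, 0 < z ∧ deriv η z = y := fun y => by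
    have : y ∈ deriv η '' Ioi 0 := h.range_deriv ▸ mem_univ y
    simpa using this
  choose g h1 h2 using this
  exact ⟨g, h1, h2⟩

/-- Strict monotonicity of `η'` turns order bounds on `g y` into open conditions on `y`; bounds `a ≤
0` hold everywhere. -/
lemma continuous_inverse (h : IsSmoothEntropy η) {g : ℝ → ℝ} (hg : ∀ y, 0 < g y)
    (hg' : ∀ y, deriv η (g y) = y) : Continuous g := by
  refine continuous_iff_continuousAt.2 fun y => tendsto_order.2 ⟨fun a ha => ?_, fun a ha => ?_⟩
  · rcases le_or_gt a 0 with h0 | h0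
    · exact Eventually.of_forall fun x => h0.trans_lt (hg x)
    · have := h.strictMonoOn_deriv h0 (hg y) ha
      rw [hg'] at this
      filter_upwards [lt_mem_nhds this] with x hx
      rwa [← hg' x, h.strictMonoOn_deriv.lt_iff_lt h0 (hg x)] at hx
  · have h0 : a ∈ Ioi (0 : ℝ) := (hg y).trans ha
    have := h.strictMonoOn_deriv (hg y) h0 ha
    rw [hg'] at this
    filter_upwards [gt_mem_nhds this] with x hx
    rwa [← hg' x, h.strictMonoOn_deriv.lt_iff_lt (hg x) h0] at hx

lemma legendreDual_eq_of_inverse (h : IsSmoothEntropy η) {g : ℝ → ℝ} (hg : ∀ y, 0 < g y)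
    (hg' : ∀ y, deriv η (g y) = y) (y : ℝ) : legendreDual η y = y * g y - η (g y) := by
  refine IsGreatest.csSup_eq ⟨⟨g y, hg y, rfl⟩, ?_⟩
  rintro _ ⟨z, hz, rfl⟩
  have := h.tangent_le (hg y) hz
  rw [hg'] at this
  dsimp only
  linarith

/-- The tangent inequalities at `g x` and `g y` trap the linearization error between `0` and `(g x -
g y)(x - y)`, so continuity of `g` suffices. -/
lemma hasDerivAt_legendreDual_of_inverse (h : IsSmoothEntropy η) {g : ℝ → ℝ}
    (hg : ∀ y, 0 < g y) (hg' : ∀ y, deriv η (g y) = y) (y : ℝ) :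
    HasDerivAt (legendreDual η) (g y) y := by
  have hc := h.continuous_inverse hg hg'
  rw [hasDerivAt_iff_isLittleO]
  have h1 : (fun x => (g x - g y) * (x - y)) =o[𝓝 y] fun x => x - y := by
    have : (fun x => g x - g y) =o[𝓝 y] fun _ => (1 : ℝ) := by
      rw [Asymptotics.isLittleO_one_iff]
      simpa using (hc.tendsto y).sub_const (g y)
    simpa using this.mul_isBigO (Asymptotics.isBigO_refl (fun x => x - y) (𝓝 y))
  refine (Asymptotics.IsBigO.of_bound' (Eventually.of_forall fun x => ?_)).trans_isLittleO h1
  have e1 := h.tangent_le (hg y) (hg x)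
  have e2 := h.tangent_le (hg x) (hg y)
  rw [hg'] at e1 e2
  rw [h.legendreDual_eq_of_inverse hg hg', h.legendreDual_eq_of_inverse hg hg', smul_eq_mul,
    Real.norm_eq_abs, Real.norm_eq_abs]
  refine abs_le_abs_of_nonneg ?_ ?_ <;> nlinarith

lemma deriv_legendreDual_of_inverse (h : IsSmoothEntropy η) {g : ℝ → ℝ} (hg : ∀ y, 0 < g y)
    (hg' : ∀ y, deriv η (g y) = y) : deriv (legendreDual η) = g :=
  funext fun y => (h.hasDerivAt_legendreDual_of_inverse hg hg' y).deriv

lemma deriv_legendreDual_pos (h : IsSmoothEntropy η) (y : ℝ) : 0 < deriv (legendreDual η) y := by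
  obtain ⟨g, h1, h2⟩ := h.exists_inverse
  rw [h.deriv_legendreDual_of_inverse h1 h2]
  exact h1 y

lemma deriv_deriv_legendreDual (h : IsSmoothEntropy η) (y : ℝ) :
    deriv η (deriv (legendreDual η) y) = y := by
  obtain ⟨g, h1, h2⟩ := h.exists_inverse
  rw [h.deriv_legendreDual_of_inverse h1 h2]
  exact h2 y

lemma hasDerivAt_legendreDual (h : IsSmoothEntropy η) (y : ℝ) :
    HasDerivAt (legendreDual η) (deriv (legendreDual η) y) y :=
  h.hasDerivAt_legendreDual_of_inverse h.deriv_legendreDual_pos h.deriv_deriv_legendreDual y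

lemma legendreDual_eq (h : IsSmoothEntropy η) (y : ℝ) :
    legendreDual η y = y * deriv (legendreDual η) y - η (deriv (legendreDual η) y) :=
  h.legendreDual_eq_of_inverse h.deriv_legendreDual_pos h.deriv_deriv_legendreDual y

lemma continuous_deriv_legendreDual (h : IsSmoothEntropy η) :
    Continuous (deriv (legendreDual η)) :=
  h.continuous_inverse h.deriv_legendreDual_pos h.deriv_deriv_legendreDual

lemma continuous_legendreDual (h : IsSmoothEntropy η) : Continuous (legendreDual η) :=
  continuous_iff_continuousAt.2 fun y => (h.hasDerivAt_legendreDual y).continuousAt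

lemma hasDerivAt_deriv_legendreDual' (h : IsSmoothEntropy η) (y : ℝ) :
    HasDerivAt (deriv (legendreDual η)) (deriv (deriv η) (deriv (legendreDual η) y))⁻¹ y :=
  HasDerivAt.of_local_left_inverse h.continuous_deriv_legendreDual.continuousAt
    (h.hasDerivAt_deriv (h.deriv_legendreDual_pos y))
    (h.deriv2_pos _ (h.deriv_legendreDual_pos y)).ne'
    (Eventually.of_forall h.deriv_deriv_legendreDual)

lemma deriv2_legendreDual (h : IsSmoothEntropy η) :
    deriv (deriv (legendreDual η)) = fun y => (deriv (deriv η) (deriv (legendreDual η) y))⁻¹ :=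
  funext fun y => (h.hasDerivAt_deriv_legendreDual' y).deriv

lemma hasDerivAt_deriv_legendreDual (h : IsSmoothEntropy η) (y : ℝ) :
    HasDerivAt (deriv (legendreDual η)) (deriv (deriv (legendreDual η)) y) y := by
  rw [h.deriv2_legendreDual]
  exact h.hasDerivAt_deriv_legendreDual' y

lemma deriv2_legendreDual_pos (h : IsSmoothEntropy η) (y : ℝ) :
    0 < deriv (deriv (legendreDual η)) y := by
  rw [h.deriv2_legendreDual]
  exact inv_pos.2 (h.deriv2_pos _ (h.deriv_legendreDual_pos y))

lemma continuous_deriv2_legendreDual (h : IsSmoothEntropy η) :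
    Continuous (deriv (deriv (legendreDual η))) := by
  rw [h.deriv2_legendreDual]
  exact (h.contDiffOn_deriv2.continuousOn.comp_continuous h.continuous_deriv_legendreDual
    h.deriv_legendreDual_pos).inv₀ fun y => (h.deriv2_pos _ (h.deriv_legendreDual_pos y)).ne'

lemma contDiff_deriv2_legendreDual (h : IsSmoothEntropy η) :
    ContDiff ℝ 1 (deriv (deriv (legendreDual η))) := by
  have hg : ContDiff ℝ 1 (deriv (legendreDual η)) :=
    contDiff_one_iff_deriv.2 ⟨fun y => (h.hasDerivAt_deriv_legendreDual y).differentiableAt,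
      h.continuous_deriv2_legendreDual⟩
  rw [h.deriv2_legendreDual]
  exact (h.contDiffOn_deriv2.comp_contDiff hg h.deriv_legendreDual_pos).inv
    fun y => (h.deriv2_pos _ (h.deriv_legendreDual_pos y)).ne'

/-- Convexity and smoothness bounds for the Legendre dual on bounded intervals. -/
lemma exists_local_bounds (h : IsSmoothEntropy η) {Y : ℝ} (hY : 0 ≤ Y) :
    ∃ c K : ℝ, 0 < c ∧ 0 < K ∧ ∀ x ∈ Icc (-Y) Y,
      c ≤ deriv (deriv (legendreDual η)) x ∧ ∀ y ∈ Icc (-Y) Y,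
      c * (y - x) ^ 2 ≤
        legendreDual η y - legendreDual η x - deriv (legendreDual η) x * (y - x) ∧
      |deriv (legendreDual η) y - deriv (legendreDual η) x| ≤ K * |y - x| ∧
      |deriv (legendreDual η) y - deriv (legendreDual η) x -
        deriv (deriv (legendreDual η)) x * (y - x)| ≤ K * |y - x| ^ 2 := by
  set f := legendreDual η with hf
  have hne : (Icc (-Y) Y).Nonempty := ⟨0, by simpa using hY⟩
  obtain ⟨x₀, -, hx₀⟩ := isCompact_Icc.exists_isMinOn hne
    h.continuous_deriv2_legendreDual.continuousOn
  obtain ⟨K₁, hK₁⟩ := isCompact_Icc.exists_bound_of_continuousOn (s := Icc (-Y) Y)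
    h.continuous_deriv2_legendreDual.continuousOn
  have hC := contDiff_one_iff_deriv.1 h.contDiff_deriv2_legendreDual
  obtain ⟨K₂, hK₂⟩ := isCompact_Icc.exists_bound_of_continuousOn (s := Icc (-Y) Y)
    hC.2.continuousOn
  have hc := h.deriv2_legendreDual_pos x₀
  have hK₁0 : 0 ≤ K₁ := (norm_nonneg _).trans (hK₁ 0 (by simpa using hY))
  have hK₂0 : 0 ≤ K₂ := (norm_nonneg _).trans (hK₂ 0 (by simpa using hY))
  -- Half the minimum of `η_*''` absorbs the Taylor factor 1/2; `K₁` and `K₂` bound `η_*''` and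
  -- `η_*'''` on the interval.
  refine ⟨deriv (deriv f) x₀ / 2, K₁ + K₂ + 1, by positivity, by positivity, fun x hx =>
    ⟨(half_le_self hc.le).trans (hx₀ hx), fun y hy => ?_⟩⟩
  have hsub : uIcc x y ⊆ Icc (-Y) Y := uIcc_subset_Icc hx hy
  refine ⟨?_, ?_, ?_⟩
  · obtain ⟨ζ, hζ, e⟩ := exists_taylor_two h.hasDerivAt_legendreDual
      h.hasDerivAt_deriv_legendreDual x y
    rw [e]
    have := hx₀ (hsub hζ)
    simp only [mem_ofPred_eq] at this
    gcongr
  · have := (convex_Icc (-Y) Y).norm_image_sub_le_of_norm_hasDerivWithin_le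
      (fun z _ => (h.hasDerivAt_deriv_legendreDual z).hasDerivWithinAt) hK₁ hx hy
    rw [Real.norm_eq_abs, Real.norm_eq_abs] at this
    refine this.trans ?_
    gcongr
    linarith
  · obtain ⟨ζ, hζ, e⟩ := exists_taylor_two h.hasDerivAt_deriv_legendreDual
      (fun z => (hC.1 z).hasDerivAt) x y
    rw [e, abs_mul, abs_pow]
    gcongr
    have := hK₂ ζ (hsub hζ)
    rw [Real.norm_eq_abs] at this
    rw [abs_div, abs_two]
    linarith [abs_nonneg (deriv (deriv (deriv f)) ζ)]

end IsSmoothEntropy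

end EntropyMoments

namespace EntropyMoments

/-! ### Abstract convex potentials -/

section

variable {E : Type*} [NormedAddCommGroup E] [InnerProductSpace ℝ E]

/-- A convex function `φ` with gradient `U` and Hessian `A`, with locally uniform bounds. -/
structure IsConvexPotential (φ : E → ℝ) (U : E → E) (A : E → E →L[ℝ] E) : Prop where
  tangent_le : ∀ α β, φ β + inner ℝ (U β) (α - β) ≤ φ α
  lipschitz : ∀ R, ∃ K, 0 < K ∧ ∀ α β, ‖α‖ ≤ R → ‖β‖ ≤ R → ‖U β - U α‖ ≤ K * ‖β - α‖
  taylor : ∀ R, ∃ K, 0 < K ∧ ∀ α β, ‖α‖ ≤ R → ‖β‖ ≤ R →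
    ‖U β - U α - A α (β - α)‖ ≤ K * ‖β - α‖ ^ 2
  strong : ∀ R, ∃ c, 0 < c ∧ ∀ α β, ‖α‖ ≤ R → ‖β‖ ≤ R →
    c * ‖α - β‖ ^ 2 ≤ φ α - φ β - inner ℝ (U β) (α - β)
  coercive : ∀ R, ∃ c, 0 < c ∧ ∀ α, ‖α‖ ≤ R → ∀ e, c * ‖e‖ ^ 2 ≤ inner ℝ (A α e) e

namespace IsConvexPotential

variable {φ : E → ℝ} {U : E → E} {A : E → E →L[ℝ] E}

lemma monotone (h : IsConvexPotential φ U A) (α β : E) : 0 ≤ inner ℝ (U α - U β) (α - β) := by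
  have h1 := h.tangent_le α β
  have h2 := h.tangent_le β α
  rw [← neg_sub α β, inner_neg_right] at h2
  rw [inner_sub_left]
  linarith

lemma injective (h : IsConvexPotential φ U A) : Function.Injective U := by
  intro α β hU
  obtain ⟨c, hc, hs⟩ := h.strong (max ‖α‖ ‖β‖)
  have h1 := hs α β (le_max_left _ _) (le_max_right _ _)
  have h2 := h.tangent_le β α
  rw [hU, ← neg_sub α β, inner_neg_right] at h2
  have h3 : ‖α - β‖ ^ 2 = 0 := by nlinarith [sq_nonneg ‖α - β‖]
  exact sub_eq_zero.1 (norm_eq_zero.1 (by simpa using h3))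

lemma continuous_U (h : IsConvexPotential φ U A) : Continuous U := by
  refine continuous_iff_continuousAt.2 fun α => ?_
  obtain ⟨K, hK, hL⟩ := h.lipschitz (‖α‖ + 1)
  rw [ContinuousAt, tendsto_iff_norm_sub_tendsto_zero]
  have ht : Tendsto (fun β => K * ‖β - α‖) (𝓝 α) (𝓝 0) := by
    have : Continuous fun β => K * ‖β - α‖ := by fun_prop
    simpa using this.tendsto α
  refine squeeze_zero' (Eventually.of_forall fun _ => norm_nonneg _) ?_ ht
  filter_upwards [Metric.ball_mem_nhds α one_pos] with β hβ
  refine hL α β (by linarith) ?_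
  have := norm_le_norm_add_norm_sub α β
  rw [mem_ball_iff_norm] at hβ
  rw [norm_sub_rev] at this
  linarith

/-- The same squeeze as for the Legendre dual, serving both `φ` and its regularized conjugate. -/
lemma hasFDerivAt_of_bregman_le {F : E → ℝ} {G : E → E} {u : E}
    (hG : Tendsto (fun w => G w - G u) (𝓝 u) (𝓝 0))
    (h0 : ∀ w, 0 ≤ F w - F u - inner ℝ (G u) (w - u))
    (h1 : ∀ w, F w - F u - inner ℝ (G u) (w - u) ≤ inner ℝ (G w - G u) (w - u)) :
    HasFDerivAt F (innerSL ℝ (G u)) u := by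
  rw [hasFDerivAt_iff_isLittleO]
  have h2 : (fun w => ‖G w - G u‖ * ‖w - u‖) =o[𝓝 u] fun w => w - u := by
    have : (fun w => ‖G w - G u‖) =o[𝓝 u] fun _ => (1 : ℝ) := by
      rw [Asymptotics.isLittleO_one_iff]
      simpa using hG.norm
    have := this.mul_isBigO (Asymptotics.isBigO_refl (fun w => ‖w - u‖) (𝓝 u))
    simp only [one_mul] at this
    exact this.of_norm_right
  refine (Asymptotics.IsBigO.of_bound' (Eventually.of_forall fun w => ?_)).trans_isLittleO h2
  rw [Real.norm_eq_abs, Real.norm_eq_abs, innerSL_apply_apply, abs_of_nonneg (h0 w),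
    abs_of_nonneg (by positivity)]
  exact (h1 w).trans (real_inner_le_norm _ _)

lemma hasFDerivAt (h : IsConvexPotential φ U A) (α : E) :
    HasFDerivAt φ (innerSL ℝ (U α)) α := by
  refine hasFDerivAt_of_bregman_le (G := U) ?_ (fun β => by linarith [h.tangent_le β α]) fun β => ?_
  · simpa using (h.continuous_U.tendsto α).sub_const (U α)
  · have := h.tangent_le α β
    rw [← neg_sub β α, inner_neg_right] at this
    rw [inner_sub_left]
    linarith

lemma continuous (h : IsConvexPotential φ U A) : Continuous φ :=
  continuous_iff_continuousAt.2 fun α => (h.hasFDerivAt α).continuousAt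

lemma hasFDerivAt_U (h : IsConvexPotential φ U A) (α : E) : HasFDerivAt U (A α) α := by
  obtain ⟨K, hK, hT⟩ := h.taylor (‖α‖ + 1)
  refine HasFDerivAt.of_isLittleO ?_
  have h2 : (fun β => K * ‖β - α‖ ^ 2) =o[𝓝 α] fun β => β - α := by
    have := (Asymptotics.isLittleO_pow_sub_sub α (m := 2) (by norm_num)).const_mul_left K
    exact this
  refine Asymptotics.IsBigO.trans_isLittleO (Asymptotics.IsBigO.of_bound 1 ?_) h2
  filter_upwards [Metric.ball_mem_nhds α one_pos] with β hβ
  rw [one_mul]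
  refine (hT α β (by linarith) ?_).trans (le_abs_self _)
  have := norm_le_norm_add_norm_sub α β
  rw [mem_ball_iff_norm] at hβ
  rw [norm_sub_rev] at this
  linarith

/-! ### Maximizers -/

/-- First-order condition. The value `γ = 0` covers the unregularized multiplier. -/
lemma eq_of_isMax (h : IsConvexPotential φ U A) {γ : ℝ} {u α : E}
    (hα : ∀ β, inner ℝ β u - φ β - γ / 2 * ‖β‖ ^ 2 ≤ inner ℝ α u - φ α - γ / 2 * ‖α‖ ^ 2) :
    U α + γ • α = u := by
  have h1 : HasFDerivAt (fun β => inner ℝ β u - φ β - γ / 2 * ‖β‖ ^ 2)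
      (innerSL ℝ u - innerSL ℝ (U α) - (γ / 2) • (2 • innerSL ℝ α)) α := by
    have e : HasFDerivAt (fun β => inner ℝ β u) (innerSL ℝ u) α := by
      have := (innerSL ℝ u).hasFDerivAt (x := α)
      convert this using 1
      funext β
      rw [innerSL_apply_apply, real_inner_comm]
    exact (e.sub (h.hasFDerivAt α)).sub ((hasStrictFDerivAt_norm_sq α).hasFDerivAt.const_mul _)
  have h2 : IsLocalMax (fun β => inner ℝ β u - φ β - γ / 2 * ‖β‖ ^ 2) α :=
    Eventually.of_forall hα
  have h3 := h2.hasFDerivAt_eq_zero h1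
  refine ext_inner_right ℝ fun e => ?_
  have h4 := congrArg (fun T : E →L[ℝ] ℝ => T e) h3
  simp only [_root_.sub_apply, _root_.smul_apply, innerSL_apply_apply,
    smul_eq_mul, nsmul_eq_mul, _root_.zero_apply] at h4
  rw [inner_add_left, real_inner_smul_left]
  push_cast at h4
  linarith

lemma isMax_of_eq (h : IsConvexPotential φ U A) {γ : ℝ} (hγ : 0 ≤ γ) {u α : E}
    (hα : U α + γ • α = u) (β : E) :
    inner ℝ β u - φ β - γ / 2 * ‖β‖ ^ 2 ≤ inner ℝ α u - φ α - γ / 2 * ‖α‖ ^ 2 := by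
  have h1 := h.tangent_le β α
  have h2 : 0 ≤ γ / 2 * ‖β - α‖ ^ 2 := by positivity
  rw [norm_sub_sq_real, real_inner_comm] at h2
  rw [inner_sub_right] at h1
  subst hα
  rw [inner_add_right, inner_add_right, real_inner_smul_right, real_inner_smul_right,
    real_inner_self_eq_norm_sq, real_inner_comm (U α) β, real_inner_comm (U α) α,
    real_inner_comm α β]
  linarith

lemma exists_isMax [FiniteDimensional ℝ E] (h : IsConvexPotential φ U A) {γ : ℝ} (hγ : 0 < γ)
    (u : E) : ∃ α, ∀ β,
      inner ℝ β u - φ β - γ / 2 * ‖β‖ ^ 2 ≤ inner ℝ α u - φ α - γ / 2 * ‖α‖ ^ 2 := by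
  have hc : Continuous fun β => -(inner ℝ β u - φ β - γ / 2 * ‖β‖ ^ 2) := by
    have := h.continuous
    fun_prop
  obtain ⟨α, hα⟩ := hc.exists_forall_le (β := E) (α := ℝ) (by
    -- The tangent plane of `φ` at `0` leaves only a linear term against the quadratic penalty,
    -- which gives coercivity.
    have hlow : ∀ β, φ 0 + ‖β‖ * (γ / 2 * ‖β‖ - ‖u - U 0‖) ≤
        -(inner ℝ β u - φ β - γ / 2 * ‖β‖ ^ 2) := fun β => by
      have h1 := h.tangent_le β 0
      have h2 := real_inner_le_norm (u - U 0) β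
      rw [inner_sub_left, real_inner_comm] at h2
      rw [sub_zero] at h1
      nlinarith
    refine tendsto_atTop_mono hlow (tendsto_atTop_add_const_left _ _ ?_)
    refine (tendsto_norm_cocompact_atTop (E := E)).atTop_mul_atTop₀ ?_
    exact tendsto_atTop_add_const_right _ _
      ((tendsto_norm_cocompact_atTop (E := E)).const_mul_atTop (by positivity)))
  exact ⟨α, fun β => by linarith [hα β]⟩

lemma strongly_monotone (h : IsConvexPotential φ U A) (γ : ℝ) (α β : E) :
    γ * ‖β - α‖ ^ 2 ≤ inner ℝ ((U β + γ • β) - (U α + γ • α)) (β - α) := by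
  have h1 := h.monotone β α
  have : (U β + γ • β) - (U α + γ • α) = (U β - U α) + γ • (β - α) := by module
  rw [this, inner_add_left, real_inner_smul_left, real_inner_self_eq_norm_sq]
  linarith

/-- The Lipschitz constant degenerates as `γ → 0`; the bound serves only for continuity of the
regularized inverse at fixed `γ`. -/
lemma norm_sub_le_reg (h : IsConvexPotential φ U A) {γ : ℝ} (hγ : 0 < γ) (α β : E) :
    ‖β - α‖ ≤ γ⁻¹ * ‖(U β + γ • β) - (U α + γ • α)‖ := by
  have h1 := (h.strongly_monotone γ α β).trans (real_inner_le_norm _ _)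
  rcases (norm_nonneg (β - α)).eq_or_lt with h0 | h0
  · rw [← h0]; positivity
  · rw [inv_mul_eq_div, le_div_iff₀ hγ]
    nlinarith

/-- Monotonicity gives `0 ≤ ⟨U α - U a, α - a⟩ = -γ⟨α, α - a⟩`, so `‖α‖² ≤ ⟨α, a⟩`. The bound is
uniform in `γ`. -/
lemma norm_le_of_reg (h : IsConvexPotential φ U A) {γ : ℝ} (hγ : 0 < γ) {a α : E}
    (hα : U α + γ • α = U a) : ‖α‖ ≤ ‖a‖ := by
  have h1 := h.monotone α a
  have h2 : U α - U a = -(γ • α) := by rw [← hα]; module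
  rw [h2, inner_neg_left, real_inner_smul_left, inner_sub_right, real_inner_self_eq_norm_sq] at h1
  have h3 := real_inner_le_norm α a
  have h4 : ‖α‖ ^ 2 ≤ inner ℝ α a := by nlinarith
  by_contra hlt
  nlinarith [norm_nonneg a]

/-! ### The inverse of the regularized gradient -/

/-- Pair the equation with `x` and drop the term `γ‖x‖²`: coercivity alone bounds `(A + γ)⁻¹`,
independently of `γ`. -/
lemma norm_inverse_le {γ c : ℝ} (hγ : 0 < γ) (hc : 0 < c) {α x y : E}
    (hcα : ∀ e, c * ‖e‖ ^ 2 ≤ inner ℝ (A α e) e) (hxy : A α x + γ • x = y) :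
    ‖x‖ ≤ c⁻¹ * ‖y‖ := by
  have h1 := real_inner_le_norm y x
  have h2 := hcα x
  rw [← hxy, inner_add_left, real_inner_smul_left, real_inner_self_eq_norm_sq, hxy] at h1
  have h3 : 0 ≤ γ * ‖x‖ ^ 2 := by positivity
  rcases (norm_nonneg x).eq_or_lt with h0 | h0
  · rw [← h0]; positivity
  · rw [inv_mul_eq_div, le_div_iff₀ hc]
    nlinarith

/-- Coercivity makes `A + γ` injective, hence invertible in finite dimension, and the continuous
inverse `a` is then differentiable. With `a = α̂_γ`, `T` is the Hessian of `h_γ`. -/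
lemma hasFDerivAt_inverse [FiniteDimensional ℝ E] (h : IsConvexPotential φ U A) {γ : ℝ}
    (hγ : 0 < γ) {a : E → E} (ha : ∀ u, U (a u) + γ • a u = u) (u : E) :
    ∃ T : E →L[ℝ] E, HasFDerivAt a T u ∧ ∀ y, A (a u) (T y) + γ • T y = y := by
  set B : E →L[ℝ] E := A (a u) + γ • ContinuousLinearMap.id ℝ E with hB
  obtain ⟨c, hc, hcα⟩ := h.coercive ‖a u‖
  have hinj : Function.Injective B.toLinearMap := by
    refine (injective_iff_map_eq_zero _).2 fun x hx => ?_
    have := norm_inverse_le hγ hc (hcα _ le_rfl) (x := x) (y := 0) (by simpa [hB] using hx)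
    simpa using this
  let e : E ≃L[ℝ] E := (LinearEquiv.ofInjectiveEndo B.toLinearMap hinj).toContinuousLinearEquiv
  have he : ∀ x, e x = A (a u) x + γ • x := fun x => rfl
  have hcont : ContinuousAt a u := by
    rw [ContinuousAt, tendsto_iff_norm_sub_tendsto_zero]
    have ht : Tendsto (fun w => γ⁻¹ * ‖w - u‖) (𝓝 u) (𝓝 0) := by
      have : Continuous fun w => γ⁻¹ * ‖w - u‖ := by fun_prop
      simpa using this.tendsto u
    refine squeeze_zero (fun _ => norm_nonneg _) (fun w => ?_) ht
    simpa [ha] using h.norm_sub_le_reg hγ (a u) (a w)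
  have hf : HasFDerivAt (fun α => U α + γ • α) (e : E →L[ℝ] E) (a u) := by
    have : (e : E →L[ℝ] E) = A (a u) + γ • ContinuousLinearMap.id ℝ E := rfl
    rw [this]
    exact (h.hasFDerivAt_U (a u)).add ((hasFDerivAt_id (a u)).const_smul γ)
  refine ⟨(e.symm : E →L[ℝ] E), hf.of_local_left_inverse hcont (Eventually.of_forall ha),
    fun y => ?_⟩
  have := he (e.symm y)
  rw [e.apply_symm_apply] at this
  exact this.symm

/-- The Bregman distance of the conjugate of the regularized potential. -/
lemma conjugate_bregman {γ : ℝ} {w u α β : E} (hα : U α + γ • α = u) (hβ : U β + γ • β = w) :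
    (inner ℝ β w - φ β - γ / 2 * ‖β‖ ^ 2) - (inner ℝ α u - φ α - γ / 2 * ‖α‖ ^ 2) -
        inner ℝ α (w - u) =
      φ α - φ β - inner ℝ (U β) (α - β) + γ / 2 * ‖β - α‖ ^ 2 := by
  subst hα hβ
  simp only [norm_sub_sq_real, inner_add_right, inner_sub_right, real_inner_smul_right,
    real_inner_self_eq_norm_sq, real_inner_comm β α, real_inner_comm (U β)]
  ring

lemma hasFDerivAt_conjugate (h : IsConvexPotential φ U A) {γ : ℝ}
    (hγ : 0 < γ) {a : E → E} (ha : ∀ u, U (a u) + γ • a u = u) (u : E) :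
    HasFDerivAt (fun u => inner ℝ (a u) u - φ (a u) - γ / 2 * ‖a u‖ ^ 2) (innerSL ℝ (a u)) u := by
  refine hasFDerivAt_of_bregman_le (G := a) ?_ (fun w => ?_) (fun w => ?_)
  · rw [tendsto_zero_iff_norm_tendsto_zero]
    have ht : Tendsto (fun w => γ⁻¹ * ‖w - u‖) (𝓝 u) (𝓝 0) := by
      have : Continuous fun w => γ⁻¹ * ‖w - u‖ := by fun_prop
      simpa using this.tendsto u
    refine squeeze_zero (fun _ => norm_nonneg _) (fun w => ?_) ht
    simpa [ha] using h.norm_sub_le_reg hγ (a u) (a w)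
  · rw [conjugate_bregman (ha u) (ha w)]
    have := h.tangent_le (a u) (a w)
    have : 0 ≤ γ / 2 * ‖a w - a u‖ ^ 2 := by positivity
    linarith
  · have h1 := conjugate_bregman (φ := φ) (ha w) (ha u)
    have := h.tangent_le (a w) (a u)
    have : 0 ≤ γ / 2 * ‖a u - a w‖ ^ 2 := by positivity
    rw [← neg_sub w u, inner_neg_right] at h1
    rw [inner_sub_left]
    linarith

/-! ### The estimate of the relative source term -/

/-- The Bregman distance based at `β` does not increase as `β` moves towards `α` along the segment.
At the point `b` at distance one from `α`, strong convexity applies. -/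
lemma bregman_ge_of_one_le (h : IsConvexPotential φ U A) {M c : ℝ}
    (hs : ∀ α β, ‖α‖ ≤ M + 1 → ‖β‖ ≤ M + 1 →
      c * ‖α - β‖ ^ 2 ≤ φ α - φ β - inner ℝ (U β) (α - β)) {α β : E} (hα : ‖α‖ ≤ M)
    (hβ : 1 < ‖β - α‖) : c ≤ φ α - φ β - inner ℝ (U β) (α - β) := by
  set n := ‖β - α‖ with hn
  have hn0 : 0 < n := by linarith
  set b : E := α + n⁻¹ • (β - α) with hb
  have h1 : ‖n⁻¹ • (β - α)‖ = 1 := by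
    rw [norm_smul, norm_inv, Real.norm_of_nonneg hn0.le, ← hn, inv_mul_cancel₀ hn0.ne']
  have h2 := hs α b (by linarith) ((norm_add_le _ _).trans (by linarith))
  have h3 : α - b = -(n⁻¹ • (β - α)) := by rw [hb]; module
  rw [h3, norm_neg, h1] at h2
  have h4 := h.tangent_le b β
  have h5 := h.monotone b β
  have h6 : b - β = (n - 1) • (α - b) := by
    have : β - α = n • (n⁻¹ • (β - α)) := by rw [smul_smul, mul_inv_cancel₀ hn0.ne', one_smul]
    have : β = α + n • (b - α) := by rw [hb, add_sub_cancel_left, ← this]; abel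
    nth_rw 1 [this]
    module
  rw [h6, real_inner_smul_right] at h5
  have h7 : 0 ≤ inner ℝ (U b - U β) (α - b) := nonneg_of_mul_nonneg_right h5 (by linarith)
  rw [inner_sub_left] at h7
  have h8 : α - β = (α - b) + (b - β) := by abel
  rw [← h3] at h2
  rw [h8, inner_add_right]
  linarith

/-- Test the tangent plane at `β` in the point `α + e`, with `e` the unit vector along `U β`; only
`φ` near `α` has to be bounded. -/
lemma norm_U_le (h : IsConvexPotential φ U A) {M K : ℝ} (hK : ∀ α, ‖α‖ ≤ M + 1 → |φ α| ≤ K)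
    {α : E} (hα : ‖α‖ ≤ M) (β : E) :
    ‖U β‖ ≤ φ α - φ β - inner ℝ (U β) (α - β) + 2 * K := by
  -- If `U β = 0`, then `e = 0`, so only `‖e‖ ≤ 1` is claimed.
  set e : E := ‖U β‖⁻¹ • U β with he
  have he1 : ‖e‖ ≤ 1 := by
    rw [he, norm_smul, norm_inv, norm_norm]
    exact inv_mul_le_one
  have he2 : inner ℝ (U β) e = ‖U β‖ := by
    rw [he, real_inner_smul_right, real_inner_self_eq_norm_sq]
    rcases (norm_nonneg (U β)).eq_or_lt with h0 | h0
    · rw [← h0]; simp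
    · field_simp
  have h1 := h.tangent_le (α + e) β
  have h2 : α + e - β = (α - β) + e := by abel
  rw [h2, inner_add_right, he2] at h1
  have h3 := abs_le.1 (hK (α + e) ((norm_add_le _ _).trans (by linarith)))
  have h4 := abs_le.1 (hK α (by linarith))
  linarith

-- Here `r` is a function of the multiplier, `a` and `α` are the exact and regularized multipliers
-- of `u`, `β` is the regularized multiplier of `u_γ`, and `x` is the Hessian of `h_γ` at `u`
-- applied to `u_γ - u`.
set_option maxHeartbeats 1000000 in
theorem exists_relSource_bound [FiniteDimensional ℝ E] (h : IsConvexPotential φ U A)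
    {r : E → E} (hr : ∀ β, inner ℝ β (r β) ≤ 0) {L : ℝ} (hL : 0 ≤ L)
    (hrL : ∀ α β, ‖r β - r α‖ ≤ L * ‖U β - U α‖) {M : ℝ} (hM : 0 < M) :
    ∃ C D : ℝ, 0 < C ∧ 0 < D ∧ ∀ a α β x : E, ∀ γ : ℝ, 0 < γ → ‖a‖ ≤ M → U α + γ • α = U a →
      A α x + γ • x = (U β + γ • β) - (U α + γ • α) →
      inner ℝ (β - α) (r β) - inner ℝ (r a) x ≤
        C * (φ α - φ β - inner ℝ (U β) (α - β) + γ / 2 * ‖β - α‖ ^ 2) + D * γ ^ 2 := by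
  obtain ⟨c, hc, hs⟩ := h.strong (M + 1)
  obtain ⟨l, hl, hco⟩ := h.coercive (M + 1)
  obtain ⟨K, hK, hlip⟩ := h.lipschitz (M + 1)
  obtain ⟨T, hT, htay⟩ := h.taylor (M + 1)
  obtain ⟨P, hP⟩ := (isCompact_closedBall (0 : E) (M + 1)).exists_bound_of_continuousOn
    h.continuous.continuousOn
  have hP' : ∀ α, ‖α‖ ≤ M + 1 → |φ α| ≤ P := fun α hα => hP α (by simpa using hα)
  have hP0 : 0 ≤ P := (abs_nonneg _).trans (hP' 0 (by rw [norm_zero]; linarith))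
  set B : ℝ := ‖r 0‖ + L * (K * M) with hB
  have hB0 : 0 ≤ B := by positivity
  have hrB : ∀ a, ‖a‖ ≤ M → ‖r a‖ ≤ B := fun a ha => by
    have h1 := hrL 0 a
    have h2 := hlip 0 a (by rw [norm_zero]; linarith) (by linarith)
    rw [sub_zero] at h2
    have h3 := norm_le_norm_add_norm_sub (r 0) (r a)
    have : L * ‖U a - U 0‖ ≤ L * (K * M) := by gcongr; exact h2.trans (by gcongr)
    rw [norm_sub_rev] at h3
    linarith
  -- `C₁` serves `‖β - α‖ ≤ 1`. For larger distances, `Z` below collects the coefficients of the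
  -- relative entropy and `X` the constants, which `S ≥ c` turns into `X / c * S`.
  set C₁ : ℝ := (L * (K + 1) + B * (l⁻¹ * T)) / c with hC₁
  set W : ℝ := ‖U 0‖ + K * M with hW
  have hW0 : 0 ≤ W := by positivity
  have hUW : ∀ a, ‖a‖ ≤ M → ‖U a‖ ≤ W := fun a ha => by
    have h2 := hlip 0 a (by rw [norm_zero]; linarith) (by linarith)
    rw [sub_zero] at h2
    have h3 := norm_le_norm_add_norm_sub (U 0) (U a)
    have : K * ‖a‖ ≤ K * M := by gcongr
    rw [norm_sub_rev] at h3
    linarith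
  set Z : ℝ := M * L + B * l⁻¹ * 3 with hZ
  set X : ℝ := M * (B + L * (2 * P + W)) + B * l⁻¹ * (2 * P + W) with hX
  have hX0 : 0 ≤ X := by positivity
  have hZ0 : 0 ≤ Z := by positivity
  refine ⟨C₁ + Z + X / c + 1, L * M ^ 2 + 1, by positivity, by positivity, ?_⟩
  intro a α β x γ hγ ha hα hx
  have hαM : ‖α‖ ≤ M := (h.norm_le_of_reg hγ hα).trans ha
  set S := φ α - φ β - inner ℝ (U β) (α - β) with hS
  have hS0 : 0 ≤ S := by have := h.tangent_le α β; linarith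
  set n := ‖β - α‖ with hn
  have hn0 : 0 ≤ n := norm_nonneg _
  have hQ : 0 ≤ γ / 2 * n ^ 2 := by positivity
  have hcα := hco α (by linarith)
  have hxs : -inner ℝ (r a) x ≤ B * ‖x‖ := by
    have := abs_real_inner_le_norm (r a) x
    have h2 : ‖r a‖ * ‖x‖ ≤ B * ‖x‖ := by gcongr; exact hrB a ha
    linarith [neg_abs_le (inner ℝ (r a) x)]
  have hD : 0 ≤ (L * M ^ 2 + 1) * γ ^ 2 := by positivity
  rcases le_or_gt n 1 with hn1 | hn1
  · have hβ : ‖β‖ ≤ M + 1 := by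
      have := norm_le_norm_add_norm_sub α β
      rw [norm_sub_rev] at this
      linarith
    have hnS : n ^ 2 ≤ S / c := by
      rw [le_div_iff₀ hc]
      have := hs α β (by linarith) hβ
      rw [norm_sub_rev, ← hn] at this
      linarith
    -- The terms in `γ` cancel: the error of `x` solves the linear equation with the Taylor
    -- remainder of `U` as right-hand side.
    have e1 : A α (x - (β - α)) + γ • (x - (β - α)) = U β - U α - A α (β - α) := by
      rw [map_sub]
      have : A α x = (U β + γ • β) - (U α + γ • α) - γ • x := by rw [← hx]; abel
      rw [this]
      module
    have e2 : ‖x - (β - α)‖ ≤ l⁻¹ * (T * n ^ 2) := by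
      refine (norm_inverse_le hγ hl hcα e1).trans ?_
      gcongr
      exact htay α β (by linarith) hβ
    have e3 : inner ℝ (β - α) (r β) - inner ℝ (r a) x =
        inner ℝ (β - α) (r β - r a) - inner ℝ (r a) (x - (β - α)) := by
      rw [inner_sub_right, inner_sub_right (r a), real_inner_comm (r a) (β - α)]
      ring
    have e4 : -inner ℝ (r a) (x - (β - α)) ≤ B * (l⁻¹ * (T * n ^ 2)) := by
      have := abs_real_inner_le_norm (r a) (x - (β - α))
      have h2 : ‖r a‖ * ‖x - (β - α)‖ ≤ B * (l⁻¹ * (T * n ^ 2)) := by gcongr; exact hrB a ha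
      linarith [neg_abs_le (inner ℝ (r a) (x - (β - α)))]
    -- The defect `U a - U α = γ • α` is the source of the `γ²` term.
    have e5 : ‖U β - U a‖ ≤ K * n + γ * M := by
      have : U β - U a = (U β - U α) - γ • α := by rw [← hα]; abel
      rw [this]
      refine (norm_sub_le _ _).trans (add_le_add (hlip α β (by linarith) hβ) ?_)
      rw [norm_smul, Real.norm_of_nonneg hγ.le]
      gcongr
    have e6 : inner ℝ (β - α) (r β - r a) ≤ n * (L * (K * n + γ * M)) := by
      refine (real_inner_le_norm _ _).trans ?_
      gcongr
      exact (hrL a β).trans (by gcongr)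
    have e7 : n * (L * (K * n + γ * M)) ≤ L * (K + 1) * n ^ 2 + L * M ^ 2 * γ ^ 2 := by
      have hp := sq_nonneg (n - γ * M)
      have : L * (n * (γ * M)) ≤ L * (n ^ 2 + γ ^ 2 * M ^ 2) := by
        gcongr
        nlinarith [sq_nonneg n, sq_nonneg (γ * M)]
      linarith
    have e8 : (L * (K + 1) + B * (l⁻¹ * T)) * n ^ 2 ≤ C₁ * S := by
      have : C₁ * S = (L * (K + 1) + B * (l⁻¹ * T)) * (S / c) := by rw [hC₁]; ring
      rw [this]
      gcongr
    have e9 : 0 ≤ (Z + X / c + 1) * S := by positivity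
    have e10 : 0 ≤ (C₁ + Z + X / c + 1) * (γ / 2 * n ^ 2) := by positivity
    have e11 : 0 ≤ γ ^ 2 := sq_nonneg γ
    rw [e3]
    linarith
  · have hSc : c ≤ S := h.bregman_ge_of_one_le hs hαM hn1
    have hUβ := h.norm_U_le hP' hαM β
    rw [← hS] at hUβ
    -- Dissipation discards `⟨β, r β⟩`, leaving the bounded factor `α`.
    have e1 : inner ℝ (β - α) (r β) ≤ M * ‖r β‖ := by
      rw [inner_sub_left]
      have h1 := abs_real_inner_le_norm α (r β)
      have h2 : ‖α‖ * ‖r β‖ ≤ M * ‖r β‖ := by gcongr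
      linarith [hr β, neg_abs_le (inner ℝ α (r β))]
    have e2 : ‖r β‖ ≤ B + L * (S + 2 * P + W) := by
      have h1 := hrL a β
      have h3 := norm_le_norm_add_norm_sub (r a) (r β)
      have h4 : ‖U β - U a‖ ≤ S + 2 * P + W :=
        (norm_sub_le _ _).trans (add_le_add hUβ (hUW a ha))
      have h5 : L * ‖U β - U a‖ ≤ L * (S + 2 * P + W) := by gcongr
      rw [norm_sub_rev] at h3
      linarith [hrB a ha]
    have e3 : ‖x‖ ≤ l⁻¹ * (S + 2 * P + W + γ * n) := by
      refine (norm_inverse_le hγ hl hcα hx).trans ?_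
      gcongr
      have : (U β + γ • β) - (U α + γ • α) = (U β - U α) + γ • (β - α) := by module
      rw [this]
      refine (norm_add_le _ _).trans (add_le_add ?_ ?_)
      · exact (norm_sub_le _ _).trans (add_le_add hUβ (hUW α hαM))
      · rw [norm_smul, Real.norm_of_nonneg hγ.le]
    -- Since `n > 1`, the penalty part of the relative entropy absorbs `γ n`.
    have e4 : γ * n ≤ 2 * (γ / 2 * n ^ 2) := by nlinarith [mul_pos hγ (sub_pos.2 hn1)]
    set Q := γ / 2 * n ^ 2 with hQd
    have e5 : M * ‖r β‖ ≤ M * (B + L * (S + 2 * P + W)) := by gcongr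
    have e6 : B * ‖x‖ ≤ B * (l⁻¹ * (S + 2 * P + W + 2 * Q)) := by
      gcongr
      exact e3.trans (by gcongr)
    have e7 : M * (B + L * (S + 2 * P + W)) + B * (l⁻¹ * (S + 2 * P + W + 2 * Q)) ≤
        Z * (S + Q) + X := by
      have p1 : 0 ≤ M * L * Q := by positivity
      have p2 : 0 ≤ B * l⁻¹ * (2 * S + Q) := by positivity
      rw [hZ, hX]
      linarith
    have e8 : X ≤ X / c * (S + Q) := by
      rw [div_mul_eq_mul_div, le_div_iff₀ hc]
      gcongr
      linarith
    have e9 : 0 ≤ (C₁ + 1) * (S + Q) := by positivity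
    linarith

end IsConvexPotential

end

end EntropyMoments

namespace EntropyMoments

/-! ### Moment integrals and weighted Gram operators -/

lemma pairing_sub {Ω : Type*} {N : ℕ} (m : Fin (N + 1) → Ω → ℝ) (α β : Vec N) (v : Ω) :
    pairing m (α - β) v = pairing m α v - pairing m β v := by
  simp [pairing, sub_mul, Finset.sum_sub_distrib]

lemma pairing_smul {Ω : Type*} {N : ℕ} (m : Fin (N + 1) → Ω → ℝ) (t : ℝ) (α : Vec N) (v : Ω) :
    pairing m (t • α) v = t * pairing m α v := by
  simp [pairing, Finset.mul_sum, mul_assoc]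

section

variable {Ω : Type*} [MeasureSpace Ω] {N : ℕ}

/-- Bounded measurable functions. -/
def IsBddMeasurable (k : Ω → ℝ) : Prop := Measurable k ∧ ∃ B, ∀ v, |k v| ≤ B

namespace IsBddMeasurable

variable {k l : Ω → ℝ}

lemma mul (hk : IsBddMeasurable k) (hl : IsBddMeasurable l) :
    IsBddMeasurable fun v => k v * l v := by
  obtain ⟨hk, B, hB⟩ := hk
  obtain ⟨hl, C, hC⟩ := hl
  refine ⟨hk.mul hl, B * C, fun v => ?_⟩
  rw [abs_mul]
  exact mul_le_mul (hB v) (hC v) (abs_nonneg _) ((abs_nonneg _).trans (hB v))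

lemma sub (hk : IsBddMeasurable k) (hl : IsBddMeasurable l) :
    IsBddMeasurable fun v => k v - l v := by
  obtain ⟨hk, B, hB⟩ := hk
  obtain ⟨hl, C, hC⟩ := hl
  exact ⟨hk.sub hl, B + C, fun v => (abs_sub _ _).trans (add_le_add (hB v) (hC v))⟩

lemma const_mul (hk : IsBddMeasurable k) (c : ℝ) : IsBddMeasurable fun v => c * k v :=
  IsBddMeasurable.mul (k := fun _ => c) ⟨measurable_const, |c|, fun _ => le_rfl⟩ hk

lemma comp (hk : IsBddMeasurable k) {F : ℝ → ℝ} (hF : Continuous F) :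
    IsBddMeasurable fun v => F (k v) := by
  obtain ⟨hk, B, hB⟩ := hk
  obtain ⟨C, hC⟩ := isCompact_Icc.exists_bound_of_continuousOn (s := Icc (-B) B) hF.continuousOn
  exact ⟨hF.measurable.comp hk, C, fun v => hC _ (abs_le.1 (hB v))⟩

lemma integrable_mul (hk : IsBddMeasurable k) (hl : Integrable l) :
    Integrable fun v => k v * l v :=
  hl.bdd_mul hk.1.aestronglyMeasurable (Eventually.of_forall hk.2.choose_spec)

lemma integrable [IsFiniteMeasure (volume : Measure Ω)] (hk : IsBddMeasurable k) :
    Integrable k := by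
  simpa using hk.integrable_mul (integrable_const (1 : ℝ))

end IsBddMeasurable

/-- The operator `e ↦ ⟨k m mᵀ⟩ e`. -/
noncomputable def weightedGram (m : Fin (N + 1) → Ω → ℝ) (k : Ω → ℝ) : Vec N →L[ℝ] Vec N :=
  (Matrix.toEuclideanLin (Matrix.of fun i j => ∫ v, m i v * (k v * m j v))).toContinuousLinearMap

lemma norm_moments_le [IsFiniteMeasure (volume : Measure Ω)] {m : Fin (N + 1) → Ω → ℝ}
    (hm : IsMomentBasis m) {k : Ω → ℝ} {B : ℝ} (hk : ∀ v, |k v| ≤ B) :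
    ‖moments m k‖ ≤ (N + 1) * (B * volume.real (univ : Set Ω)) := by
  have h1 : ‖moments m k‖ ≤ ∑ i, ‖moments m k i‖ := by
    rw [EuclideanSpace.norm_eq]
    refine Real.sqrt_le_iff.2 ⟨by positivity, ?_⟩
    exact Finset.sum_sq_le_sq_sum_of_nonneg fun i _ => norm_nonneg _
  refine h1.trans ?_
  have h2 : ∀ i, ‖moments m k i‖ ≤ B * volume.real (univ : Set Ω) := fun i => by
    refine norm_integral_le_of_norm_le_const (Eventually.of_forall fun v => ?_)
    rw [Real.norm_eq_abs, abs_mul]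
    calc |m i v| * |k v| ≤ 1 * B :=
          mul_le_mul (hm.abs_le_one i v) (hk v) (abs_nonneg _) zero_le_one
      _ = B := one_mul B
  refine (Finset.sum_le_sum fun i _ => h2 i).trans_eq ?_
  simp

namespace IsMomentBasis

variable {m : Fin (N + 1) → Ω → ℝ}

lemma isBddMeasurable (hm : IsMomentBasis m) (i : Fin (N + 1)) : IsBddMeasurable (m i) :=
  ⟨hm.measurable i, 1, hm.abs_le_one i⟩

lemma abs_pairing_le (hm : IsMomentBasis m) (α : Vec N) (v : Ω) :
    |pairing m α v| ≤ (N + 1) * ‖α‖ := by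
  refine (Finset.abs_sum_le_sum_abs _ _).trans ?_
  have : ∀ i, |α i * m i v| ≤ ‖α‖ := fun i => by
    rw [abs_mul]
    calc |α i| * |m i v| ≤ ‖α‖ * 1 :=
          mul_le_mul (PiLp.norm_apply_le α i) (hm.abs_le_one i v) (abs_nonneg _)
            (norm_nonneg _)
      _ = ‖α‖ := mul_one _
  refine (Finset.sum_le_sum fun i _ => this i).trans_eq ?_
  simp

lemma isBddMeasurable_pairing (hm : IsMomentBasis m) (α : Vec N) :
    IsBddMeasurable (pairing m α) := by
  refine ⟨?_, _, hm.abs_pairing_le α⟩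
  unfold pairing
  exact Finset.measurable_fun_sum _ fun i _ => (hm.measurable i).const_mul _

lemma inner_moments (hm : IsMomentBasis m) {k : Ω → ℝ} (hk : Integrable k) (e : Vec N) :
    inner ℝ (moments m k) e = ∫ v, pairing m e v * k v := by
  simp only [PiLp.inner_apply, moments, pairing, Finset.sum_mul]
  rw [integral_finsetSum]
  · refine Finset.sum_congr rfl fun i _ => ?_
    simp only [RCLike.inner_apply, conj_trivial, mul_assoc]
    rw [integral_const_mul]
  · intro i _
    simp only [mul_assoc]
    exact ((hm.isBddMeasurable i).integrable_mul hk).const_mul _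

lemma moments_sub (hm : IsMomentBasis m) {k l : Ω → ℝ} (hk : Integrable k) (hl : Integrable l) :
    moments m (fun v => k v - l v) = moments m k - moments m l := by
  ext i
  simp only [moments, PiLp.sub_apply, mul_sub]
  exact integral_sub ((hm.isBddMeasurable i).integrable_mul hk)
    ((hm.isBddMeasurable i).integrable_mul hl)

variable [IsFiniteMeasure (volume : Measure Ω)]

lemma weightedGram_apply (hm : IsMomentBasis m) {k : Ω → ℝ} (hk : IsBddMeasurable k) (e : Vec N) :
    weightedGram m k e = moments m (fun v => k v * pairing m e v) := by
  ext i
  simp only [weightedGram, LinearMap.coe_toContinuousLinearMap', moments, pairing,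
    Finset.mul_sum]
  rw [integral_finsetSum]
  · simp only [Matrix.ofLp_toLpLin, Matrix.toLin'_apply, Matrix.mulVec, dotProduct, Matrix.of_apply]
    refine Finset.sum_congr rfl fun j _ => ?_
    rw [← integral_mul_const]
    refine integral_congr_ae (Eventually.of_forall fun v => ?_)
    dsimp only
    ring
  · intro j _
    exact ((hm.isBddMeasurable i).mul (hk.mul ((hm.isBddMeasurable j).const_mul _))).integrable

lemma inner_weightedGram (hm : IsMomentBasis m) {k : Ω → ℝ} (hk : IsBddMeasurable k)
    (e e' : Vec N) :
    inner ℝ (weightedGram m k e) e' = ∫ v, pairing m e' v * (k v * pairing m e v) := by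
  rw [hm.weightedGram_apply hk,
    hm.inner_moments (hk.mul (hm.isBddMeasurable_pairing e)).integrable]

/-- The quadratic form `e ↦ ⟨(e · m)²⟩` is positive definite. -/
lemma exists_gram_lower_bound (hm : IsMomentBasis m) :
    ∃ l, 0 < l ∧ ∀ e : Vec N, l * ‖e‖ ^ 2 ≤ ∫ v, pairing m e v ^ 2 := by
  have hone : IsBddMeasurable fun _ : Ω => (1 : ℝ) :=
    ⟨measurable_const, 1, fun _ => abs_one.le⟩
  have hQ : ∀ e : Vec N, ∫ v, pairing m e v ^ 2 = inner ℝ (weightedGram m (fun _ => 1) e) e :=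
    fun e => by
      rw [hm.inner_weightedGram hone]
      simp only [one_mul, sq]
  have hc : Continuous fun e : Vec N => inner ℝ (weightedGram m (fun _ => 1) e) e := by fun_prop
  -- The minimum over the unit sphere is positive by linear independence modulo null sets;
  -- homogeneity gives the rest.
  obtain ⟨e₀, he₀, hmin⟩ := (isCompact_sphere (0 : Vec N) 1).exists_isMinOn
    (NormedSpace.sphere_nonempty.2 zero_le_one) hc.continuousOn
  have hnorm : ‖e₀‖ = 1 := by simpa using he₀
  refine ⟨∫ v, pairing m e₀ v ^ 2, ?_, fun e => ?_⟩
  · have h0 : 0 ≤ ∫ v, pairing m e₀ v ^ 2 := integral_nonneg fun v => sq_nonneg _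
    refine h0.lt_of_ne' fun hz => ?_
    have hi : Integrable fun v => pairing m e₀ v ^ 2 := by
      simpa only [sq] using
        ((hm.isBddMeasurable_pairing e₀).mul (hm.isBddMeasurable_pairing e₀)).integrable
    rw [integral_eq_zero_iff_of_nonneg (fun v => sq_nonneg _) hi] at hz
    have : e₀ = 0 := by
      refine hm.linearIndependent e₀ ?_
      filter_upwards [hz] with v hv
      simpa [pairing] using hv
    rw [this, norm_zero] at hnorm
    exact zero_ne_one hnorm
  · rcases eq_or_ne e 0 with rfl | he
    · simpa using integral_nonneg fun v => sq_nonneg (pairing m 0 v)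
    · have hn : ‖e‖ ≠ 0 := norm_ne_zero_iff.2 he
      have h1 : ‖e‖⁻¹ • e ∈ Metric.sphere (0 : Vec N) 1 := by
        simp [norm_smul, hn]
      have h2 := hmin h1
      simp only [mem_ofPred_eq] at h2
      rw [← hQ, ← hQ] at h2
      simp only [pairing_smul, mul_pow] at h2
      rw [integral_const_mul] at h2
      calc (∫ v, pairing m e₀ v ^ 2) * ‖e‖ ^ 2
          ≤ (‖e‖⁻¹ ^ 2 * ∫ v, pairing m e v ^ 2) * ‖e‖ ^ 2 := by gcongr
        _ = ∫ v, pairing m e v ^ 2 := by field_simp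

end IsMomentBasis

/-! ### The potential `α ↦ ⟨η_*(α · m)⟩` -/

variable {m : Fin (N + 1) → Ω → ℝ} {η : ℝ → ℝ}

lemma isBddMeasurable_ansatz (hm : IsMomentBasis m) (hη : IsSmoothEntropy η) (α : Vec N) :
    IsBddMeasurable (ansatz η m α) :=
  (hm.isBddMeasurable_pairing α).comp hη.continuous_deriv_legendreDual

variable [IsFiniteMeasure (volume : Measure Ω)]

lemma bregman_eq_integral (hm : IsMomentBasis m) (hη : IsSmoothEntropy η) (α β : Vec N) :
    (∫ v, legendreDual η (pairing m α v)) - (∫ v, legendreDual η (pairing m β v)) -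
        inner ℝ (uHat η m β) (α - β) =
      ∫ v, (legendreDual η (pairing m α v) - legendreDual η (pairing m β v) -
        ansatz η m β v * (pairing m α v - pairing m β v)) := by
  have h1 := fun α => ((hm.isBddMeasurable_pairing α).comp hη.continuous_legendreDual)
  have h2 := isBddMeasurable_ansatz hm hη β
  rw [integral_sub ((h1 α).sub (h1 β)).integrable
    (h2.mul ((hm.isBddMeasurable_pairing α).sub (hm.isBddMeasurable_pairing β))).integrable,
    integral_sub (h1 α).integrable (h1 β).integrable, uHat, hm.inner_moments h2.integrable]
  congr 1
  refine integral_congr_ae (Eventually.of_forall fun v => ?_)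
  simp only [pairing_sub]
  ring

/-- The Hessian of the potential. -/
noncomputable def hessianPotential (η : ℝ → ℝ) (m : Fin (N + 1) → Ω → ℝ) (α : Vec N) :
    Vec N →L[ℝ] Vec N :=
  weightedGram m fun v => deriv (deriv (legendreDual η)) (pairing m α v)

/-- On a ball of multipliers, `α·m(v)` stays in one compact interval for all `v`, so the scalar
bounds on `η_*` are uniform in `v`. Integrating them, with the Gram lower bound for the two coercive
estimates, gives every field. -/
theorem isConvexPotential (hm : IsMomentBasis m) (hη : IsSmoothEntropy η) :
    IsConvexPotential (fun α : Vec N => ∫ v, legendreDual η (pairing m α v)) (uHat η m)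
      (hessianPotential η m) := by
  have hbdd : ∀ R : ℝ, ∃ c K : ℝ, 0 < c ∧ 0 < K ∧ ∀ α : Vec N, ‖α‖ ≤ R → ∀ v,
      c ≤ deriv (deriv (legendreDual η)) (pairing m α v) ∧ ∀ β : Vec N, ‖β‖ ≤ R →
      c * pairing m (β - α) v ^ 2 ≤ legendreDual η (pairing m β v) -
        legendreDual η (pairing m α v) - ansatz η m α v * (pairing m β v - pairing m α v) ∧
      |ansatz η m β v - ansatz η m α v| ≤ K * ‖β - α‖ ∧
      |ansatz η m β v - ansatz η m α v -
        deriv (deriv (legendreDual η)) (pairing m α v) * pairing m (β - α) v| ≤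
          K * ‖β - α‖ ^ 2 := by
    intro R
    obtain ⟨c, K, hc, hK, h⟩ := hη.exists_local_bounds (Y := (N + 1) * |R|) (by positivity)
    have hmem : ∀ α : Vec N, ‖α‖ ≤ R → ∀ v,
        pairing m α v ∈ Icc (-((N + 1) * |R|)) ((N + 1) * |R|) := fun α hα v => by
      refine abs_le.1 ((hm.abs_pairing_le α v).trans ?_)
      gcongr
      exact hα.trans (le_abs_self R)
    refine ⟨c, K * (N + 1) ^ 2, hc, by positivity, fun α hα v => ?_⟩
    obtain ⟨h1, h2⟩ := h _ (hmem α hα v)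
    refine ⟨h1, fun β hβ => ?_⟩
    obtain ⟨h3, h4, h5⟩ := h2 _ (hmem β hβ v)
    have hp := hm.abs_pairing_le (β - α) v
    rw [← pairing_sub] at h3 h4 h5
    refine ⟨by rw [← pairing_sub]; exact h3, h4.trans ?_, h5.trans ?_⟩
    · calc K * |pairing m (β - α) v| ≤ K * ((N + 1) * ‖β - α‖) := by gcongr
        _ ≤ K * (N + 1) ^ 2 * ‖β - α‖ := by
          rw [← mul_assoc]
          gcongr
          nlinarith [(Nat.cast_nonneg N : (0 : ℝ) ≤ N)]
    · calc K * |pairing m (β - α) v| ^ 2 ≤ K * ((N + 1) * ‖β - α‖) ^ 2 := by gcongr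
        _ = K * (N + 1) ^ 2 * ‖β - α‖ ^ 2 := by ring
  have hA := isBddMeasurable_ansatz hm hη
  have hH := fun α => (hm.isBddMeasurable_pairing α).comp hη.continuous_deriv2_legendreDual
  have hP := hm.isBddMeasurable_pairing
  have hL := fun α => (hP α).comp hη.continuous_legendreDual
  have hsq : ∀ e : Vec N, Integrable fun v => pairing m e v ^ 2 := fun e => by
    simpa only [sq] using ((hP e).mul (hP e)).integrable
  obtain ⟨l, hl, hgram⟩ := hm.exists_gram_lower_bound
  set V := volume.real (univ : Set Ω) with hV
  have hV0 : 0 ≤ V := measureReal_nonneg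
  have hstrong : ∀ R : ℝ, ∃ c, 0 < c ∧ ∀ α β : Vec N, ‖α‖ ≤ R → ‖β‖ ≤ R →
      c * ‖α - β‖ ^ 2 ≤ (∫ v, legendreDual η (pairing m α v)) -
        (∫ v, legendreDual η (pairing m β v)) - inner ℝ (uHat η m β) (α - β) := by
    intro R
    obtain ⟨c, K, hc, hK, h⟩ := hbdd R
    refine ⟨c * l, by positivity, fun α β hα hβ => ?_⟩
    rw [bregman_eq_integral hm hη, mul_assoc]
    refine (mul_le_mul_of_nonneg_left (hgram (α - β)) hc.le).trans ?_
    rw [← integral_const_mul]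
    exact integral_mono ((hsq _).const_mul _)
      (((hL α).sub (hL β)).sub ((hA β).mul ((hP α).sub (hP β)))).integrable
      fun v => ((h β hβ v).2 α hα).1
  refine ⟨fun α β => ?_, fun R => ?_, fun R => ?_, hstrong, fun R => ?_⟩
  -- Any two points lie in a common ball, so the local estimate yields the global tangent
  -- inequality.
  · obtain ⟨c, hc, h⟩ := hstrong (max ‖α‖ ‖β‖)
    have := h α β (le_max_left _ _) (le_max_right _ _)
    have : 0 ≤ c * ‖α - β‖ ^ 2 := by positivity
    linarith
  · obtain ⟨c, K, hc, hK, h⟩ := hbdd R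
    refine ⟨(N + 1) * (K * V) + 1, by positivity, fun α β hα hβ => ?_⟩
    rw [uHat, uHat, ← hm.moments_sub (hA β).integrable (hA α).integrable]
    refine (norm_moments_le hm fun v => ((h α hα v).2 β hβ).2.1).trans ?_
    rw [← hV]
    linarith [norm_nonneg (β - α)]
  · obtain ⟨c, K, hc, hK, h⟩ := hbdd R
    refine ⟨(N + 1) * (K * V) + 1, by positivity, fun α β hα hβ => ?_⟩
    rw [uHat, uHat, ← hm.moments_sub (hA β).integrable (hA α).integrable, hessianPotential,
      hm.weightedGram_apply (hH α), ← hm.moments_sub ((hA β).sub (hA α)).integrable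
        ((hH α).mul (hP _)).integrable]
    refine (norm_moments_le hm fun v => ((h α hα v).2 β hβ).2.2).trans ?_
    rw [← hV]
    linarith [sq_nonneg ‖β - α‖]
  · obtain ⟨c, K, hc, hK, h⟩ := hbdd R
    refine ⟨c * l, by positivity, fun α hα e => ?_⟩
    rw [hessianPotential, hm.inner_weightedGram (hH α), mul_assoc]
    refine (mul_le_mul_of_nonneg_left (hgram e) hc.le).trans ?_
    rw [← integral_const_mul]
    refine integral_mono ((hsq _).const_mul _) ((hP e).mul ((hH α).mul (hP e))).integrable
      fun v => ?_
    have := mul_le_mul_of_nonneg_right (h α hα v).1 (sq_nonneg (pairing m e v))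
    dsimp only
    linarith

/-! ### Multipliers, entropy and source terms -/

lemma uHat_alphaHatReg (hm : IsMomentBasis m) (hη : IsSmoothEntropy η) {γ : ℝ} (hγ : 0 < γ)
    (u : Vec N) :
    uHat η m (alphaHatReg η m γ u) + γ • alphaHatReg η m γ u = u :=
  (isConvexPotential hm hη).eq_of_isMax
    (Classical.epsilon_spec ((isConvexPotential hm hη).exists_isMax hγ u))

/-- `α` is a maximizer, every maximizer has the same `û`, and `û` is injective. -/
lemma alphaHat_uHat (hm : IsMomentBasis m) (hη : IsSmoothEntropy η) (α : Vec N) :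
    alphaHat η m (uHat η m α) = α := by
  have hp := isConvexPotential hm hη
  have h1 : ∃ α' : Vec N, ∀ β : Vec N,
      inner ℝ β (uHat η m α) - (∫ v, legendreDual η (pairing m β v)) ≤
        inner ℝ α' (uHat η m α) - ∫ v, legendreDual η (pairing m α' v) :=
    ⟨α, fun β => by
      simpa using hp.isMax_of_eq le_rfl (u := uHat η m α) (α := α) (by simp) β⟩
  have h2 : ∀ β : Vec N, inner ℝ β (uHat η m α) - (∫ v, legendreDual η (pairing m β v)) ≤
      inner ℝ (alphaHat η m (uHat η m α)) (uHat η m α) -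
        ∫ v, legendreDual η (pairing m (alphaHat η m (uHat η m α)) v) := Classical.epsilon_spec h1
  have h3 := hp.eq_of_isMax (γ := 0) (u := uHat η m α) (α := alphaHat η m (uHat η m α))
    (by simpa using h2)
  rw [zero_smul, add_zero] at h3
  exact hp.injective h3

lemma integral_entropy_ansatz (hm : IsMomentBasis m) (hη : IsSmoothEntropy η) (α : Vec N) :
    ∫ v, η (ansatz η m α v) =
      inner ℝ α (uHat η m α) - ∫ v, legendreDual η (pairing m α v) := by
  have hA := isBddMeasurable_ansatz hm hη α
  rw [real_inner_comm, uHat, hm.inner_moments hA.integrable, ← integral_sub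
    ((hm.isBddMeasurable_pairing α).mul hA).integrable
    ((hm.isBddMeasurable_pairing α).comp hη.continuous_legendreDual).integrable]
  refine integral_congr_ae (Eventually.of_forall fun v => ?_)
  dsimp only
  rw [hη.legendreDual_eq, ansatz]
  ring

/-- `h_γ` is the conjugate of `φ + γ/2 ‖·‖²`: since `û(α) - u = -γα`, the penalty is `γ/2 ‖α‖²`, and
the Legendre identity `η(G_α) = (α·m) G_α - η_*(α·m)` handles the entropy. -/
lemma entropyReg_eq (hm : IsMomentBasis m) (hη : IsSmoothEntropy η) {γ : ℝ} (hγ : 0 < γ)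
    (u : Vec N) :
    entropyReg η m γ u = inner ℝ (alphaHatReg η m γ u) u -
      (∫ v, legendreDual η (pairing m (alphaHatReg η m γ u) v)) -
        γ / 2 * ‖alphaHatReg η m γ u‖ ^ 2 := by
  have h := uHat_alphaHatReg hm hη hγ u
  set α := alphaHatReg η m γ u with hα
  have h1 : moments m (ansatz η m α) - u = -(γ • α) := by
    calc uHat η m α - u = uHat η m α - (uHat η m α + γ • α) := by rw [h]
      _ = -(γ • α) := by abel
  have h2 : inner ℝ α u = inner ℝ α (uHat η m α) + γ * ‖α‖ ^ 2 := by
    nth_rw 1 [← h]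
    rw [inner_add_right, real_inner_smul_right, real_inner_self_eq_norm_sq]
  rw [entropyReg, ← hα, integral_entropy_ansatz hm hη, h1, norm_neg, norm_smul,
    Real.norm_of_nonneg hγ.le, h2]
  field_simp
  ring

lemma gradient_entropyReg (hm : IsMomentBasis m) (hη : IsSmoothEntropy η) {γ : ℝ} (hγ : 0 < γ) :
    gradient (entropyReg η m γ) = alphaHatReg η m γ := by
  funext u
  refine HasGradientAt.gradient (hasGradientAt_iff_hasFDerivAt.2 ?_)
  rw [funext (entropyReg_eq hm hη hγ)]
  exact (isConvexPotential hm hη).hasFDerivAt_conjugate hγ (uHat_alphaHatReg hm hη hγ) u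

lemma relEntropyReg_eq (hm : IsMomentBasis m) (hη : IsSmoothEntropy η) {γ : ℝ} (hγ : 0 < γ)
    (w u : Vec N) :
    relEntropyReg η m γ w u =
      (∫ v, legendreDual η (pairing m (alphaHatReg η m γ u) v)) -
        (∫ v, legendreDual η (pairing m (alphaHatReg η m γ w) v)) -
        inner ℝ (uHat η m (alphaHatReg η m γ w)) (alphaHatReg η m γ u - alphaHatReg η m γ w) +
        γ / 2 * ‖alphaHatReg η m γ w - alphaHatReg η m γ u‖ ^ 2 := by
  rw [relEntropyReg, entropyReg_eq hm hη hγ, entropyReg_eq hm hη hγ]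
  exact IsConvexPotential.conjugate_bregman
    (φ := fun α : Vec N => ∫ v, legendreDual η (pairing m α v))
    (uHat_alphaHatReg hm hη hγ u) (uHat_alphaHatReg hm hη hγ w)

lemma ansatz_mem_densities (hm : IsMomentBasis m) (hη : IsSmoothEntropy η) (α : Vec N) :
    ansatz η m α ∈ Densities Ω :=
  ⟨(isBddMeasurable_ansatz hm hη α).integrable, fun _ => hη.deriv_legendreDual_pos _⟩

/-- Since `η'(G_α) = α·m`, this is entropy dissipation at `G_α`; the product is integrable because
`α·m` is bounded. -/
lemma inner_source_nonpos (hm : IsMomentBasis m) {coll : (Ω → ℝ) → Ω → ℝ}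
    (hη : IsSuperlinearEntropy coll η) (hη' : IsSmoothEntropy η) (α : Vec N)
    (hcoll : Integrable (coll (ansatz η m α))) :
    inner ℝ α (moments m (coll (ansatz η m α))) ≤ 0 := by
  have e : ∀ v, deriv η (ansatz η m α v) = pairing m α v := fun v =>
    hη'.deriv_deriv_legendreDual _
  have h := hη.dissipation _ (ansatz_mem_densities hm hη' α)
  simp only [e] at h
  rw [real_inner_comm, hm.inner_moments hcoll]
  exact h ((hm.isBddMeasurable_pairing α).integrable_mul hcoll)

theorem exists_relSource_le (hm : IsMomentBasis m) (coll : (Ω → ℝ) → Ω → ℝ)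
    (hη : IsSuperlinearEntropy coll η)
    (hcoll : ∀ α : Vec N, Integrable (coll (ansatz η m α))) {L : NNReal}
    (hlip : LipschitzOnWith L (source coll η m) (realizable m)) {M : ℝ} (hM : 0 < M) :
    ∃ C D : ℝ, 0 < C ∧ 0 < D ∧ ∀ w : Vec N, ∀ u ∈ realizableBall η m M, ∀ γ : ℝ, 0 < γ →
      relSource coll η m γ w u ≤ C * relEntropyReg η m γ w u + D * γ ^ 2 := by
  have hs : IsSmoothEntropy η := ⟨hη.contDiffOn, hη.deriv2_pos, hη.range_deriv⟩
  have hp := isConvexPotential hm hs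
  have hsource : ∀ α : Vec N,
      source coll η m (uHat η m α) = moments m (coll (ansatz η m α)) := fun α => by
    rw [source, alphaHat_uHat hm hs]
  have hmem : ∀ α : Vec N, uHat η m α ∈ realizable m := fun α =>
    ⟨ansatz η m α, ansatz_mem_densities hm hs α, rfl⟩
  obtain ⟨C, D, hC, hD, h⟩ := hp.exists_relSource_bound
    (r := fun α => moments m (coll (ansatz η m α)))
    (fun α => inner_source_nonpos hm hη hs α (hcoll α)) L.2
    (fun α β => by
      have := hlip.norm_sub_le (hmem β) (hmem α)
      rwa [hsource, hsource] at this) hM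
  refine ⟨C, D, hC, hD, ?_⟩
  rintro w _ ⟨a, ha, rfl⟩ γ hγ
  have hα := uHat_alphaHatReg hm hs hγ (uHat η m a)
  have hβ := uHat_alphaHatReg hm hs hγ w
  obtain ⟨T, hT, hTA⟩ := hp.hasFDerivAt_inverse hγ (uHat_alphaHatReg hm hs hγ) (uHat η m a)
  rw [relSource, gradient_entropyReg hm hs hγ, relEntropyReg_eq hm hs hγ, hT.fderiv, hsource,
    sourceReg]
  exact h a _ _ _ γ hγ ha hα (by rw [hTA, hα, hβ])

end

end EntropyMoments

/-! ### The estimate on a bounded velocity domain -/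

theorem mainTheorem7 {d N : ℕ}
    (V : Set (EuclideanSpace ℝ (Fin d))) (hVm : MeasurableSet V) (hVb : Bornology.IsBounded V)
    (m : Fin (N + 1) → V → ℝ) (hm : EntropyMoments.IsMomentBasis m)
    (coll : (V → ℝ) → V → ℝ) (η : ℝ → ℝ)
    (hη : EntropyMoments.IsSuperlinearEntropy coll η)
    (hcoll : ∀ α : EntropyMoments.Vec N, Integrable (coll (EntropyMoments.ansatz η m α)))
    (hlip : ∃ Cr : NNReal,
      LipschitzOnWith Cr (EntropyMoments.source coll η m) (EntropyMoments.realizable m))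
    (hzero : Tendsto (EntropyMoments.source coll η m)
      (𝓝[EntropyMoments.realizable m] 0) (𝓝 0))
    (M γ₀ : ℝ) (hM : 0 < M) (hγ₀ : 0 < γ₀) :
    ∃ Cq Dq : ℝ, 0 < Cq ∧ 0 < Dq ∧
      ∀ w : EntropyMoments.Vec N, ∀ u ∈ EntropyMoments.realizableBall η m M, ∀ γ ∈ Ioo 0 γ₀,
        EntropyMoments.relSource coll η m γ w u ≤
          Cq * EntropyMoments.relEntropyReg η m γ w u + Dq * γ ^ 2 := by
  have : IsFiniteMeasure (volume : Measure V) :=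
    ⟨by rw [Measure.Subtype.volume_univ hVm.nullMeasurableSet]; exact hVb.measure_lt_top⟩
  obtain ⟨L, hL⟩ := hlip
  obtain ⟨C, D, hC, hD, h⟩ := EntropyMoments.exists_relSource_le hm coll hη hcoll hL hM
  exact ⟨C, D, hC, hD, fun w u hu γ hγ => h w u hu γ hγ.1⟩
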